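/- Let $\xi$ be a probability measure on $\{0,1,2,\dots\}$ and, for each $k\ge 1$, let $\eta^{(k)}$ be a probability measure on $\{-1,0,1\}^k$. Let $T$ be the labelled Galton--Watson tree whose root has label $0$, with offspring distribution $\xi$ and displacement laws $\eta^{(k)}$: a finite rooted plane tree $t$, with integer labels changing by $-1$, $0$ or $1$ along each edge and root label $0$, has probability $$\Pi_0(t)=\prod_{v\in V(t)}\xi(k_t(v))\,\eta^{(k_t(v))}([v]_t),$$ where $k_t(v)$ is the number of children of $v$, $[v]_t$ is the vector of label increments from $v$ to its children listed from left to right, and $\eta^{(0)}(\varnothing)=1$. For $l\in\{-1,1\}$ consider the number of vertices of $T$ that have label $l$ and no strict ancestor with label $l$. Let $\nu_-$ be its law for $l=1$, and $\nu_+$ its law for $l=-1$. For a probability measure $\nu$ on $\{0,1,2,\dots\}$ write $g_\nu(z)=\sum_{k\ge0}\nu(k)z^k$ for $z\in[0,1]$. In each of the following four cases $\nu_+$ and $\nu_-$ are probability measures and $\nu_+=\nu_-=:\nu$, and $g_\nu(z)$ is given for every $z\in[0,1]$ by the stated formula; in cases 1 and 2 the right-hand side at $z=0$ is understood as its limit as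 $z\downarrow 0$, which is $5/8$ in case 1 and $2/3$ in case 2. 1. If $\xi(k)=2^{-k-1}$ for all $k\ge0$ and $\eta^{(k)}=\mathcal U(\{-1,1\})^{\otimes k}$ for all $k\ge1$, then $$g_\nu(z)=\frac{-2z^2+9z-4+2\sqrt{4-z}\,(1-z)^{3/2}}{z(4-z)}.$$ 2. If $\xi(k)=2^{-k-1}$ for all $k\ge0$ and $\eta^{(k)}=\mathcal U(\{-1,0,1\})^{\otimes k}$ for all $k\ge1$, then $$g_\nu(z)=\frac{-z^2+6z-3+\sqrt{9-z}\,(1-z)^{3/2}}{2z}.$$ 3. (Incomplete binary trees.) If $\xi=\frac14\delta_0+\frac12\delta_1+\frac14\delta_2$, $\eta^{(1)}=\frac12(\delta_{-1}+\delta_1)$ and $\eta^{(2)}=\delta_{(-1,1)}$, then $$g_\nu(z)=\frac{-z^2+16z-3+\sqrt{49-z}\,(1-z)^{3/2}}{2(z+5)}.$$ 4. (Complete binary trees.) If $\xi=\frac12(\delta_0+\delta_2)$ and $\eta^{(2)}=\delta_{(-1,1)}$, then $$g_\nu(z)=\frac{-z^2+10z-3+\sqrt{25-z}\,(1-z)^{3/2}}{2(z+2)}.$$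 -/

import Mathlib

open scoped ENNReal Topology

noncomputable section

/-- `LTree x` is the set of finite labelled rooted plane trees whose root carries the label `x : ℤ`
and whose labels change by `-1`, `0` or `1` along each edge: the root has `k ≥ 0` ordered children,
the `i`-th edge out of the root carries the displacement `s i ∈ {-1, 0, 1}`, and the `i`-th child is
the root of a labelled plane tree with root label `x + s i`. -/
inductive LTree : ℤ → Type
  | node (x : ℤ) (k : ℕ) (s : Fin k → SignType) (c : (i : Fin k) → LTree (x + (s i : ℤ))) : LTree x

namespace LTree

/-- The weight `Π(t) = ∏_{v ∈ V(t)} ξ(k_t(v)) η^{(k_t(v))}([v]_t)` of a labelled plane tree, where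
`k_t(v)` is the number of children of `v` and `[v]_t` is the vector of label displacements from `v`
to its children. On `LTree x` this is the mass function of the law of the labelled Galton--Watson
tree rooted at `x`. For `k = 0` the law `η 0` is the unit mass at the empty vector. -/
def weight (ξ : PMF ℕ) (η : (k : ℕ) → PMF (Fin k → SignType)) : {x : ℤ} → LTree x → ℝ≥0∞
  | _, node _ k s c => ξ k * η k s * ∏ i, weight ξ η (c i)

/-- Truncation at level `l`: delete all vertices having a strict ancestor with label `l`. -/
def trunc (l : ℤ) : {x : ℤ} → LTree x → LTree x
  | _, node x k s c =>
    if x = l then node x 0 Fin.elim0 (fun i => i.elim0)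
    else node x k s (fun i => trunc l (c i))

/-- The number of leaves with label `l`. -/
def leaves (l : ℤ) : {x : ℤ} → LTree x → ℕ
  | _, node x k _ c => if k = 0 then (if x = l then 1 else 0) else ∑ i, leaves l (c i)

/-- The number of leaves with label `l` in the truncation at level `l`, that is, the number of
vertices with label `l` that have no strict ancestor with label `l`. -/
def hits (l : ℤ) {x : ℤ} (t : LTree x) : ℕ := leaves l (trunc l t)

end LTree

/-- The law of `hits l T` for a labelled Galton--Watson tree `T` rooted at `0`. -/
def hitLaw (ξ : PMF ℕ) (η : (k : ℕ) → PMF (Fin k → SignType)) (l : ℤ) (n : ℕ) : ℝ≥0∞ :=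
  ∑' t : {t : LTree 0 // LTree.hits l t = n}, LTree.weight ξ η t.1

/-- `ν_-`: the law of the number of first hitting points of level `1`. -/
def nuMinus (ξ : PMF ℕ) (η : (k : ℕ) → PMF (Fin k → SignType)) : ℕ → ℝ≥0∞ := hitLaw ξ η 1

/-- `ν_+`: the law of the number of first hitting points of level `-1`. -/
def nuPlus (ξ : PMF ℕ) (η : (k : ℕ) → PMF (Fin k → SignType)) : ℕ → ℝ≥0∞ := hitLaw ξ η (-1)

/-- The generating function `g_ν(z) = ∑_k ν(k) z^k` (used for probability distributions `ν` on `ℕ`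
and `z ∈ [0, 1]`, where the series converges). -/
def genFun (ν : ℕ → ℝ≥0∞) (z : ℝ) : ℝ := ∑' k, (ν k).toReal * z ^ k

/-- The critical geometric distribution `ξ(k) = 2^{-k-1}`. -/
def critGeometric : PMF ℕ :=
  ⟨fun k => (2⁻¹ : ℝ≥0∞) ^ (k + 1), by
    rw [← ENNReal.tsum_two_zpow_neg_add_one]
    convert ENNReal.summable.hasSum using 3 with k
    rw [show (-1 - (k : ℤ)) = -((k + 1 : ℕ) : ℤ) by push_cast; ring, ENNReal.zpow_neg, zpow_natCast,
      ENNReal.inv_pow]⟩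

/-- The distribution `(1/4) δ_0 + (1/2) δ_1 + (1/4) δ_2`. -/
def incompleteBinary : PMF ℕ :=
  PMF.ofFinset (fun k => if k = 0 then 4⁻¹ else if k = 1 then 2⁻¹ else if k = 2 then 4⁻¹ else 0)
    {0, 1, 2} (by
      have h : (4⁻¹ : ℝ≥0∞) = 2⁻¹ * 2⁻¹ := by
        rw [← ENNReal.mul_inv (by simp) (by simp)]; norm_num
      simp only [Finset.sum_insert, Finset.mem_insert, Finset.mem_singleton, Finset.sum_singleton,
        h, zero_ne_one, OfNat.zero_ne_ofNat, OfNat.one_ne_ofNat, or_self, not_false_eq_true,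
        if_true, if_false, one_ne_zero, OfNat.ofNat_ne_zero, OfNat.ofNat_ne_one]
      rw [add_comm (2⁻¹ : ℝ≥0∞), ← add_assoc, ← mul_add, ENNReal.inv_two_add_inv_two, mul_one,
        ENNReal.inv_two_add_inv_two])
    (by intro a ha; simp only [Finset.mem_insert, Finset.mem_singleton, not_or] at ha; simp [ha])

/-- The distribution `(1/2) (δ_0 + δ_2)`. -/
def completeBinary : PMF ℕ := PMF.uniformOfFinset {0, 2} (by simp)

/-- The product law `u^{⊗ k}` on `{-1, 0, 1}^k`. -/
def iidSteps (u : PMF SignType) (k : ℕ) : PMF (Fin k → SignType) :=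
  PMF.ofFintype (fun s => ∏ i, u (s i)) (by
    have h : ∑ a, u a = 1 := by rw [← u.tsum_coe, tsum_fintype]
    simpa [h] using Finset.sum_prod_piFinset (ι := Fin k) Finset.univ (fun _ a => u a))

end

/-! Fix a target label and let `h n` be the generating function at `z` of the number of first hits,
for a tree started at distance `n` from the target. Decomposing at the root gives `h (n + 1) = F (h
n) (h (n + 1)) (h (n + 2))`, with `F` read off from the offspring and displacement laws, while `h 0
= z` times the probability that the tree is finite. That probability solves the same recursion on
all of `ℤ`; there it is concave and bounded, hence constant, hence `1` (`mass_eq_one`).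

A bounded solution is determined by `h 0`. After the change of variable `1 - h`, or a logarithm in
the binary cases, the second difference is a nondecreasing function of the value, so the difference
of two solutions is convex where positive and cannot grow from `0` while staying bounded
(`eq_of_bounded_solutions`). Each recursion also has an explicit one-parameter family of solutions,
rational in `(p + n) ^ 2`. Choosing `p` to match `h 0 = z` and reading off `h 1` gives `g_ν(z)`;
clearing the square roots from the denominator gives the stated formulas. -/

/-! ### Branching recursions for sums over labelled trees. -/

theorem ENNReal.tsum_pi_prod {n : ℕ} {α : Fin n → Type*} (f : (i : Fin n) → α i → ℝ≥0∞) :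
    ∑' c : (i : Fin n) → α i, ∏ i, f i (c i) = ∏ i, ∑' a, f i a := by
  induction n with
  | zero => simp
  | succ n ih =>
    rw [← (Fin.consEquiv α).tsum_eq, ENNReal.tsum_prod', Fin.prod_univ_succ,
      ← ih fun i => f i.succ, ← ENNReal.tsum_mul_right]
    refine tsum_congr fun a => ?_
    rw [← ENNReal.tsum_mul_left]
    refine tsum_congr fun c => ?_
    simp [Fin.consEquiv, Fin.prod_univ_succ]

namespace LTree

/-- A labelled tree is a displacement vector together with the subtrees of the children. -/
def nodeEquiv (x : ℤ) :
    (Σ k : ℕ, Σ s : Fin k → SignType, (i : Fin k) → LTree (x + (s i : ℤ))) ≃ LTree x where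
  toFun p := node x p.1 p.2.1 p.2.2
  invFun | node _ k s c => ⟨k, s, c⟩
  left_inv _ := rfl
  right_inv | node _ _ _ _ => rfl

theorem tsum_eq_node {x : ℤ} (f : LTree x → ℝ≥0∞) :
    ∑' t, f t = ∑' k, ∑ s : Fin k → SignType, ∑' c, f (node x k s c) := by
  rw [← (nodeEquiv x).tsum_eq, ENNReal.tsum_sigma']
  refine tsum_congr fun k => ?_
  rw [ENNReal.tsum_sigma', tsum_fintype]
  rfl

variable (ξ : PMF ℕ) (η : (k : ℕ) → PMF (Fin k → SignType))

/-- The expectation of `∏ f(label of child)` over the children of a vertex with label `x`. -/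
noncomputable def offspring (f : ℤ → ℝ≥0∞) (x : ℤ) : ℝ≥0∞ :=
  ∑' k, ξ k * ∑ s : Fin k → SignType, η k s * ∏ i, f (x + (s i : ℤ))

variable {ξ η} in
theorem offspring_le_one {f : ℤ → ℝ≥0∞} (hf : ∀ x, f x ≤ 1) (x : ℤ) :
    offspring ξ η f x ≤ 1 := by
  rw [← ξ.tsum_coe]
  refine ENNReal.tsum_le_tsum fun k => ?_
  refine mul_le_of_le_one_right' ?_
  calc _ ≤ ∑ s : Fin k → SignType, η k s :=
        Finset.sum_le_sum fun s _ => mul_le_of_le_one_right' (Finset.prod_le_one' fun i _ => hf _)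
    _ = 1 := by rw [← (η k).tsum_coe, tsum_fintype]

/-- Branching property: given the displacements at the root, the subtrees vary independently, so the
sum of a product over children is a product of sums. It yields every recursion below. -/
theorem tsum_node_eq_offspring (g : {y : ℤ} → LTree y → ℝ≥0∞) (f : {y : ℤ} → LTree y → ℝ≥0∞) {x : ℤ}
    (h : ∀ k s c, f (node x k s c) = ξ k * η k s * ∏ i, g (c i)) :
    ∑' t : LTree x, f t = offspring ξ η (fun y => ∑' t : LTree y, g t) x := by
  rw [tsum_eq_node, offspring]
  refine tsum_congr fun k => ?_
  rw [Finset.mul_sum]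
  refine Finset.sum_congr rfl fun s _ => ?_
  simp_rw [h, ENNReal.tsum_mul_left, mul_assoc]
  rw [ENNReal.tsum_pi_prod fun i => g]

/-- The weight of a tree, set to zero if the tree has `d` generations or more. -/
noncomputable def weightBelow : ℕ → {x : ℤ} → LTree x → ℝ≥0∞
  | 0, _, _ => 0
  | d + 1, _, node _ k s c => ξ k * η k s * ∏ i, weightBelow d (c i)

theorem exists_weightBelow_eq {x : ℤ} (t : LTree x) :
    ∃ d, ∀ e, d ≤ e → weightBelow ξ η e t = weight ξ η t := by
  induction t with
  | node x k s c ih =>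
    choose d hd using ih
    refine ⟨Finset.univ.sup d + 1, fun e he => ?_⟩
    obtain ⟨e, rfl⟩ : ∃ e', e = e' + 1 := ⟨e - 1, by omega⟩
    simp only [weightBelow, weight]
    congr 1
    refine Finset.prod_congr rfl fun i _ => hd i e ?_
    exact (Finset.le_sup (Finset.mem_univ i)).trans (by omega)

theorem tsum_weightBelow_le_one (d : ℕ) (x : ℤ) : ∑' t : LTree x, weightBelow ξ η d t ≤ 1 := by
  induction d generalizing x with
  | zero => simp [weightBelow]
  | succ d ih =>
    rw [tsum_node_eq_offspring ξ η (weightBelow ξ η d) (weightBelow ξ η (d + 1))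
      (fun k s c => rfl)]
    exact offspring_le_one ih x

/-- A finite set of trees has bounded height, so its total weight is dominated by a
height-restricted sum, which is at most `1` by induction on the height. -/
theorem tsum_weight_le_one (x : ℤ) : ∑' t : LTree x, weight ξ η t ≤ 1 := by
  rw [ENNReal.tsum_eq_iSup_sum]
  refine iSup_le fun S => ?_
  choose d hd using fun t : LTree x => exists_weightBelow_eq ξ η t
  calc ∑ t ∈ S, weight ξ η t = ∑ t ∈ S, weightBelow ξ η (S.sup d) t :=
        Finset.sum_congr rfl fun t ht => (hd t _ (Finset.le_sup ht)).symm
    _ ≤ _ := ENNReal.sum_le_tsum S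
    _ ≤ 1 := tsum_weightBelow_le_one ξ η _ x

/-- The probability that the tree rooted at `x` is finite. -/
noncomputable def mass (x : ℤ) : ℝ≥0∞ := ∑' t : LTree x, weight ξ η t

theorem mass_eq (x : ℤ) : mass ξ η x = offspring ξ η (mass ξ η) x :=
  tsum_node_eq_offspring ξ η (weight ξ η) (weight ξ η) (fun _ _ _ => rfl)

theorem hits_node_self {l : ℤ} (k : ℕ) (s : Fin k → SignType)
    (c : (i : Fin k) → LTree (l + (s i : ℤ))) : hits l (node l k s c) = 1 := by
  simp [hits, trunc, leaves]

theorem hits_node_of_ne {x l : ℤ} (h : x ≠ l) (k : ℕ) (s : Fin k → SignType)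
    (c : (i : Fin k) → LTree (x + (s i : ℤ))) : hits l (node x k s c) = ∑ i, hits l (c i) := by
  obtain rfl | hk := eq_or_ne k 0
  · simp [hits, trunc, leaves, h]
  · simp [hits, trunc, leaves, h, hk]

/-- The generating function of the number of first hitting points of `l`, starting from `x`. -/
noncomputable def hitGen (l : ℤ) (z : ℝ≥0∞) (x : ℤ) : ℝ≥0∞ :=
  ∑' t : LTree x, weight ξ η t * z ^ hits l t

/-- The root is already the only first hit. What lies below it is unconstrained and contributes the
factor `mass`. -/
theorem hitGen_self (l : ℤ) (z : ℝ≥0∞) : hitGen ξ η l z l = mass ξ η l * z := by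
  rw [hitGen, mass, ← ENNReal.tsum_mul_right]
  refine tsum_congr fun t => ?_
  obtain ⟨_, k, s, c⟩ := t
  rw [hits_node_self, pow_one]

theorem hitGen_of_ne {l x : ℤ} (h : x ≠ l) (z : ℝ≥0∞) :
    hitGen ξ η l z x = offspring ξ η (hitGen ξ η l z) x := by
  refine tsum_node_eq_offspring ξ η (fun t => weight ξ η t * z ^ hits l t)
    (fun t => weight ξ η t * z ^ hits l t) (fun k s c => ?_)
  rw [hits_node_of_ne h, Finset.prod_mul_distrib, Finset.prod_pow_eq_pow_sum, weight, mul_assoc]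

theorem hitGen_le_one (l : ℤ) {z : ℝ≥0∞} (hz : z ≤ 1) (x : ℤ) : hitGen ξ η l z x ≤ 1 :=
  (ENNReal.tsum_le_tsum fun _ => mul_le_of_le_one_right' (pow_le_one' hz _)).trans
    (tsum_weight_le_one ξ η x)

theorem tsum_hitLaw_mul_pow (l : ℤ) (z : ℝ≥0∞) :
    ∑' n, hitLaw ξ η l n * z ^ n = hitGen ξ η l z 0 := by
  rw [hitGen, ← (Equiv.sigmaFiberEquiv (hits l (x := 0))).tsum_eq, ENNReal.tsum_sigma']
  refine tsum_congr fun n => ?_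
  rw [hitLaw, ← ENNReal.tsum_mul_right]
  refine tsum_congr fun t => ?_
  simp [Equiv.sigmaFiberEquiv, t.2]

theorem tsum_hitLaw (l : ℤ) : ∑' n, hitLaw ξ η l n = mass ξ η 0 := by
  simpa [hitGen, mass] using tsum_hitLaw_mul_pow ξ η l 1

theorem hitLaw_le_one (l : ℤ) (n : ℕ) : hitLaw ξ η l n ≤ 1 :=
  (ENNReal.le_tsum n).trans ((tsum_hitLaw ξ η l).trans_le (tsum_weight_le_one ξ η 0))

theorem genFun_hitLaw (l : ℤ) {z : ℝ} (h0 : 0 ≤ z) :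
    genFun (hitLaw ξ η l) z = (hitGen ξ η l (ENNReal.ofReal z) 0).toReal := by
  rw [← tsum_hitLaw_mul_pow, ENNReal.tsum_toReal_eq]
  · refine tsum_congr fun n => ?_
    simp [h0]
  · intro n
    exact ENNReal.mul_ne_top (ne_top_of_le_ne_top ENNReal.one_ne_top (hitLaw_le_one ξ η l n))
      (ENNReal.pow_ne_top ENNReal.ofReal_ne_top)

end LTree

/-! ### Discrete convexity and uniqueness principles. -/

/-- A sequence that is bounded above and convex cannot increase. -/
theorem le_of_convex_of_bounded {d : ℕ → ℝ} {C : ℝ} (hC : ∀ n, d n ≤ C)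
    (hd : ∀ n, d 0 < d (n + 1) → 2 * d (n + 1) ≤ d n + d (n + 2)) : d 1 ≤ d 0 := by
  by_contra! h
  -- After a first increase the sequence stays above `d 0`, so the convexity hypothesis keeps
  -- applying and the increments never shrink. Growth is then at least linear.
  have key : ∀ n, d 0 < d (n + 1) ∧ d 1 - d 0 ≤ d (n + 1) - d n := by
    intro n
    induction n with
    | zero => exact ⟨h, le_rfl⟩
    | succ n ih =>
      have := hd n ih.1
      exact ⟨by linarith [ih.1], by linarith [ih.2]⟩
  have lin : ∀ n : ℕ, n * (d 1 - d 0) ≤ d n - d 0 := by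
    intro n
    induction n with
    | zero => simp
    | succ n ih => push_cast; linarith [(key n).2]
  obtain ⟨n, hn⟩ := exists_nat_gt ((C - d 0) / (d 1 - d 0))
  rw [div_lt_iff₀ (sub_pos.2 h)] at hn
  linarith [lin n, hC n]

/-- Two bounded solutions of a second order recursion with the same initial value, whose second
differences are ordered as the values, have the same second term. -/
theorem eq_of_bounded_solutions {a b : ℕ → ℝ} {C : ℝ} (hC : ∀ n, |a n - b n| ≤ C)
    (h0 : a 0 = b 0)
    (hab : ∀ n, b (n + 1) < a (n + 1) →
      b n + b (n + 2) - 2 * b (n + 1) ≤ a n + a (n + 2) - 2 * a (n + 1))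
    (hba : ∀ n, a (n + 1) < b (n + 1) →
      a n + a (n + 2) - 2 * a (n + 1) ≤ b n + b (n + 2) - 2 * b (n + 1)) : a 1 = b 1 := by
  refine le_antisymm ?_ ?_
  · have := le_of_convex_of_bounded (d := fun n => a n - b n) (C := C)
      (fun n => (le_abs_self _).trans (hC n)) fun n hn => by
        have := hab n (by simp only [h0, sub_self] at hn; linarith)
        linarith
    simp only [h0, sub_self] at this
    linarith
  · have := le_of_convex_of_bounded (d := fun n => b n - a n) (C := C)
      (fun n => by rw [← neg_sub]; exact (neg_le_abs _).trans (hC n)) fun n hn => by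
        have := hba n (by simp only [h0, sub_self] at hn; linarith)
        linarith
    simp only [h0, sub_self] at this
    linarith

/-- Power series with bounded coefficients that agree on `(0, 1)` have the same coefficients. -/
theorem eq_of_tsum_mul_pow_eq {a b : ℕ → ℝ} {C : ℝ} (ha : ∀ n, |a n| ≤ C) (hb : ∀ n, |b n| ≤ C)
    (h : ∀ z : ℝ, 0 < z → z < 1 → ∑' n, a n * z ^ n = ∑' n, b n * z ^ n) : a = b := by
  have key : ∀ c : ℕ → ℝ, (∀ n, |c n| ≤ C) → HasFPowerSeriesAt (fun z => ∑' n, c n * z ^ n)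
      (FormalMultilinearSeries.ofScalars ℝ c) 0 := by
    intro c hc
    have hr : (1 : ℝ≥0∞) ≤ (FormalMultilinearSeries.ofScalars ℝ c).radius := by
      refine FormalMultilinearSeries.le_radius_of_bound (r := 1) _ C fun n => ?_
      simpa [FormalMultilinearSeries.ofScalars_norm] using hc n
    have := (FormalMultilinearSeries.hasFPowerSeriesOnBall _ (one_pos.trans_le hr)).hasFPowerSeriesAt
    convert this using 2 with z
    simp [FormalMultilinearSeries.sum, mul_comm]
  -- Agreement is known only to the right of `0`, but these points accumulate at `0`, so the
  -- identity theorem for analytic functions applies.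
  have hev : (fun z : ℝ => ∑' n, a n * z ^ n) =ᶠ[𝓝 0] fun z => ∑' n, b n * z ^ n := by
    rw [Filter.EventuallyEq, ← AnalyticAt.frequently_eq_iff_eventually_eq (key a ha).analyticAt
      (key b hb).analyticAt]
    have : ∀ᶠ z : ℝ in 𝓝[>] 0, ∑' n, a n * z ^ n = ∑' n, b n * z ^ n := by
      filter_upwards [Ioo_mem_nhdsGT (zero_lt_one' ℝ)] with z hz using h z hz.1 hz.2
    exact this.frequently.filter_mono (nhdsWithin_mono _ fun z hz => ne_of_gt hz)
  exact FormalMultilinearSeries.ofScalars_series_injective (E := ℝ) ℝ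
    (((key a ha).congr hev).eq_formalMultilinearSeries (key b hb))

/-! ### Reduction to a scalar second-order recursion. -/

namespace LTree

variable {ξ : PMF ℕ} {η : (k : ℕ) → PMF (Fin k → SignType)} {F : ℝ → ℝ → ℝ → ℝ} {g : ℝ → ℝ}

/-- The offspring operator of `ξ` and `η` acts on functions with values in `[0, 1]` through the
values at the vertex and at its two neighbours, as prescribed by `F`. -/
def IsStep (ξ : PMF ℕ) (η : (k : ℕ) → PMF (Fin k → SignType)) (F : ℝ → ℝ → ℝ → ℝ) : Prop :=
  ∀ f : ℤ → ℝ≥0∞, (∀ x, f x ≤ 1) → ∀ x, (offspring ξ η f x).toReal =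
    F (f (x - 1)).toReal (f x).toReal (f (x + 1)).toReal

theorem toReal_mem_Icc {a : ℝ≥0∞} (h : a ≤ 1) : a.toReal ∈ Set.Icc (0 : ℝ) 1 :=
  ⟨ENNReal.toReal_nonneg, ENNReal.toReal_le_of_le_ofReal zero_le_one (by simpa using h)⟩

/-- By `hconv` the mass is a concave function on `ℤ`. Being bounded below, it can decrease in
neither direction, so it is constant, and `hfix` leaves only the value `1`. -/
theorem mass_eq_one (hF : IsStep ξ η F)
    (hconv : ∀ a ∈ Set.Icc (0 : ℝ) 1, ∀ b ∈ Set.Icc (0 : ℝ) 1, ∀ c ∈ Set.Icc (0 : ℝ) 1,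
      b = F a b c → a + c ≤ 2 * b)
    (hfix : ∀ b ∈ Set.Icc (0 : ℝ) 1, b = F b b b → b = 1) (x : ℤ) : mass ξ η x = 1 := by
  have hle : ∀ x, mass ξ η x ≤ 1 := tsum_weight_le_one ξ η
  have hI := fun x => toReal_mem_Icc (hle x)
  have hrec : ∀ x, (mass ξ η x).toReal = F (mass ξ η (x - 1)).toReal (mass ξ η x).toReal
      (mass ξ η (x + 1)).toReal := fun x => by
    conv_lhs => rw [mass_eq]
    exact hF _ hle x
  have hc := fun x => hconv _ (hI _) _ (hI _) _ (hI _) (hrec x)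
  have hup : ∀ x, (mass ξ η x).toReal ≤ (mass ξ η (x + 1)).toReal := fun x => by
    have := le_of_convex_of_bounded (d := fun n : ℕ => -(mass ξ η (x + n)).toReal) (C := 0)
      (fun n => by simp) fun n _ => by
        have := hc (x + n + 1)
        push_cast
        rw [add_sub_cancel_right] at this
        rw [show x + ((n : ℤ) + 2) = x + n + 1 + 1 by ring, ← add_assoc]
        linarith
    simpa using this
  have hdown : ∀ x, (mass ξ η (x + 1)).toReal ≤ (mass ξ η x).toReal := fun x => by
    have := le_of_convex_of_bounded (d := fun n : ℕ => -(mass ξ η (x + 1 - n)).toReal) (C := 0)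
      (fun n => by simp) fun n _ => by
        have := hc (x - n)
        push_cast
        rw [show x + 1 - ((n : ℤ) + 2) = x - n - 1 by ring,
          show x + 1 - ((n : ℤ) + 1) = x - n by ring, show x + 1 - (n : ℤ) = x - n + 1 by ring]
        linarith
    simpa using this
  have hs := fun x => le_antisymm (hup x) (hdown x)
  have hr := hrec x
  rw [← hs x, show (mass ξ η (x - 1)).toReal = (mass ξ η x).toReal by
    simpa using hs (x - 1)] at hr
  have := hfix _ (hI x) hr
  rwa [ENNReal.toReal_eq_one_iff] at this

/-- Symmetry of `F` makes the recursions towards `1` and `-1` identical, so both generating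
functions equal `g`. The two laws then coincide because power series determine their coefficients.
-/
theorem hitLaw_of_isStep (hF : IsStep ξ η F) (hsymm : ∀ a b c, F a b c = F c b a)
    (hconv : ∀ a ∈ Set.Icc (0 : ℝ) 1, ∀ b ∈ Set.Icc (0 : ℝ) 1, ∀ c ∈ Set.Icc (0 : ℝ) 1,
      b = F a b c → a + c ≤ 2 * b)
    (hfix : ∀ b ∈ Set.Icc (0 : ℝ) 1, b = F b b b → b = 1)
    (huniq : ∀ h : ℕ → ℝ, (∀ n, h n ∈ Set.Icc (0 : ℝ) 1) →
      (∀ n, h (n + 1) = F (h n) (h (n + 1)) (h (n + 2))) → h 1 = g (h 0)) :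
    (∑' n, nuPlus ξ η n) = 1 ∧ nuMinus ξ η = nuPlus ξ η ∧
      ∀ z : ℝ, 0 ≤ z → z ≤ 1 → genFun (nuPlus ξ η) z = g z := by
  have hm := mass_eq_one hF hconv hfix
  have hgen : ∀ l z, z ≤ 1 → ∀ x, x ≠ l → (hitGen ξ η l z x).toReal =
      F (hitGen ξ η l z (x - 1)).toReal (hitGen ξ η l z x).toReal
        (hitGen ξ η l z (x + 1)).toReal := fun l z hz x hx => by
    conv_lhs => rw [hitGen_of_ne ξ η hx]
    exact hF _ (hitGen_le_one ξ η l hz) x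
  have hplus : ∀ z : ℝ, 0 ≤ z → z ≤ 1 → genFun (nuPlus ξ η) z = g z := by
    intro z h0 h1
    have hz : ENNReal.ofReal z ≤ 1 := by simpa using h1
    -- The index is the distance to the target: label `n - 1` is at distance `n` from `-1`, and the
    -- root label `0` has index `1`.
    have := huniq (fun n => (hitGen ξ η (-1) (ENNReal.ofReal z) (n - 1)).toReal)
      (fun n => toReal_mem_Icc (hitGen_le_one ξ η _ hz _)) fun n => by
        have := hgen (-1) _ hz n (by omega)
        push_cast
        rwa [add_sub_cancel_right, show (n : ℤ) + 2 - 1 = n + 1 by ring]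
    simp only [Nat.cast_one, sub_self, Nat.cast_zero, zero_sub, hitGen_self, hm, one_mul,
      ENNReal.toReal_ofReal h0] at this
    rw [nuPlus, genFun_hitLaw ξ η _ h0, this]
  have hminus : ∀ z : ℝ, 0 ≤ z → z ≤ 1 → genFun (nuMinus ξ η) z = g z := by
    intro z h0 h1
    have hz : ENNReal.ofReal z ≤ 1 := by simpa using h1
    have := huniq (fun n => (hitGen ξ η 1 (ENNReal.ofReal z) (1 - n)).toReal)
      (fun n => toReal_mem_Icc (hitGen_le_one ξ η _ hz _)) fun n => by
        have := hgen 1 _ hz (-n) (by omega)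
        rw [hsymm] at this
        push_cast
        rwa [show 1 - ((n : ℤ) + 1) = -n by ring, show 1 - ((n : ℤ) + 2) = -n - 1 by ring,
          show 1 - (n : ℤ) = -n + 1 by ring]
    simp only [Nat.cast_one, sub_self, Nat.cast_zero, sub_zero, hitGen_self, hm, one_mul,
      ENNReal.toReal_ofReal h0] at this
    rw [nuMinus, genFun_hitLaw ξ η _ h0, this]
  refine ⟨(tsum_hitLaw ξ η _).trans (hm 0), ?_, hplus⟩
  have hb : ∀ l n, |(hitLaw ξ η l n).toReal| ≤ 1 := fun l n => by
    rw [abs_of_nonneg ENNReal.toReal_nonneg]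
    exact (toReal_mem_Icc (hitLaw_le_one ξ η l n)).2
  have := eq_of_tsum_mul_pow_eq (hb 1) (hb (-1)) fun z h0 h1 =>
    (hminus z h0.le h1.le).trans (hplus z h0.le h1.le).symm
  funext n
  exact (ENNReal.toReal_eq_toReal_iff' (ne_top_of_le_ne_top ENNReal.one_ne_top
    (hitLaw_le_one ξ η _ n)) (ne_top_of_le_ne_top ENNReal.one_ne_top
    (hitLaw_le_one ξ η _ n))).1 (congrFun this n)

end LTree

/-! ### Uniqueness and explicit solutions for the particular recursions. -/

/-- The map `x ↦ x ^ 2 / (1 - x)` is increasing on `[0, 1)`, so second differences are ordered as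
the values. -/
theorem eq_of_bounded_solutions_of_div {a b : ℕ → ℝ} {c : ℝ} (hc : 0 ≤ c)
    (ha : ∀ n, a n ∈ Set.Icc (0 : ℝ) 1) (hb : ∀ n, b n ∈ Set.Icc (0 : ℝ) 1)
    (ha1 : ∀ n, a (n + 1) < 1) (hb1 : ∀ n, b (n + 1) < 1) (h0 : a 0 = b 0)
    (hra : ∀ n, a n + a (n + 2) - 2 * a (n + 1) = c * (a (n + 1) ^ 2 / (1 - a (n + 1))))
    (hrb : ∀ n, b n + b (n + 2) - 2 * b (n + 1) = c * (b (n + 1) ^ 2 / (1 - b (n + 1)))) :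
    a 1 = b 1 := by
  have mono : ∀ x y : ℝ, 0 ≤ x → x < y → y < 1 → c * (x ^ 2 / (1 - x)) ≤ c * (y ^ 2 / (1 - y)) := by
    intro x y hx hxy hy
    have : 0 < 1 - y := by linarith
    gcongr
  refine eq_of_bounded_solutions (C := 1) (fun n => ?_) h0 (fun n h => ?_) (fun n h => ?_)
  · rw [abs_le]
    constructor <;> linarith [(ha n).1, (ha n).2, (hb n).1, (hb n).2]
  · rw [hra, hrb]
    exact mono _ _ (hb _).1 h (ha1 n)
  · rw [hra, hrb]
    exact mono _ _ (ha _).1 h (hb1 n)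

/-- Logarithms turn the product into a second difference, equal to the logarithm of `4 (x - 1) / x ^
2`, which increases with `x` on `(1, 2]`. -/
theorem eq_of_bounded_solutions_of_mul {u v : ℕ → ℝ}
    (hu : ∀ n, u n ∈ Set.Icc (0 : ℝ) 2) (hv : ∀ n, v n ∈ Set.Icc (0 : ℝ) 2) (h0 : v 0 = u 0)
    (hru : ∀ n, u n * u (n + 2) = 4 * (u (n + 1) - 1))
    (hrv : ∀ n, v n * v (n + 2) = 4 * (v (n + 1) - 1)) : v 1 = u 1 := by
  -- A zero initial value has no usable logarithm, but then the recursion at `n = 0` forces both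
  -- second terms to be `1`.
  obtain hz | hz := (hu 0).1.eq_or_lt
  · have h1 := hru 0
    have h2 := hrv 0
    simp only [h0, ← hz, zero_mul, zero_add] at h1 h2
    linarith
  have ge_one : ∀ w : ℕ → ℝ, (∀ n, w n ∈ Set.Icc (0 : ℝ) 2) →
      (∀ n, w n * w (n + 2) = 4 * (w (n + 1) - 1)) → ∀ n, 1 ≤ w (n + 1) := by
    intro w hw hrw n
    linarith [hrw n, mul_nonneg (hw n).1 (hw (n + 2)).1]
  have pos : ∀ w : ℕ → ℝ, (∀ n, w n ∈ Set.Icc (0 : ℝ) 2) → 0 < w 0 →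
      (∀ n, w n * w (n + 2) = 4 * (w (n + 1) - 1)) → ∀ n, 0 < w n := by
    intro w hw hw0 hrw n
    cases n with
    | zero => exact hw0
    | succ n => linarith [ge_one w hw hrw n]
  have gt_one : ∀ w : ℕ → ℝ, (∀ n, w n ∈ Set.Icc (0 : ℝ) 2) → 0 < w 0 →
      (∀ n, w n * w (n + 2) = 4 * (w (n + 1) - 1)) → ∀ n, 1 < w (n + 1) := by
    intro w hw hw0 hrw n
    linarith [hrw n, mul_pos (pos w hw hw0 hrw n) (pos w hw hw0 hrw (n + 2))]
  have hlog : ∀ w : ℕ → ℝ, (∀ n, w n ∈ Set.Icc (0 : ℝ) 2) → 0 < w 0 →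
      (∀ n, w n * w (n + 2) = 4 * (w (n + 1) - 1)) → ∀ n,
      Real.log (w n) + Real.log (w (n + 2)) - 2 * Real.log (w (n + 1)) =
        Real.log (4 * (w (n + 1) - 1) / w (n + 1) ^ 2) := by
    intro w hw hw0 hrw n
    have hp := pos w hw hw0 hrw
    have h1 := gt_one w hw hw0 hrw n
    rw [← Real.log_mul (hp _).ne' (hp _).ne', hrw,
      Real.log_div (by nlinarith) (pow_ne_zero _ (hp _).ne'), Real.log_pow]
    norm_num
  have mono : ∀ x y : ℝ, 1 < x → x < y → y ≤ 2 →
      Real.log (4 * (x - 1) / x ^ 2) ≤ Real.log (4 * (y - 1) / y ^ 2) := by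
    intro x y hx hxy hy
    have hx0 : 0 < x := by linarith
    have hy0 : 0 < y := by linarith
    have hx1 : 0 < x - 1 := by linarith
    refine Real.log_le_log (by positivity) ?_
    rw [div_le_div_iff₀ (by positivity) (by positivity)]
    -- This product is exactly `(y - 1) x ^ 2 - (x - 1) y ^ 2`, the cross-multiplied inequality.
    have : 0 ≤ (y - x) * (1 - (x - 1) * (y - 1)) :=
      mul_nonneg (by linarith) (by nlinarith)
    nlinarith
  have hv0 : 0 < v 0 := h0 ▸ hz
  have key := eq_of_bounded_solutions (a := fun n => Real.log (v n)) (b := fun n => Real.log (u n))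
    (C := Real.log 2) (fun n => ?_) (by simp only [h0]) (fun n h => ?_) (fun n h => ?_)
  · exact Real.log_injOn_pos (pos v hv hv0 hrv 1) (pos u hu hz hru 1) key
  -- The initial value may be arbitrarily close to `0`, but there the logarithms agree; later terms
  -- lie in `[1, 2]`, whence the bound `log 2`.
  · cases n with
    | zero => simpa [h0] using Real.log_nonneg one_le_two
    | succ n =>
      have h1 := Real.log_nonneg (ge_one u hu hru n)
      have h2 := Real.log_nonneg (ge_one v hv hrv n)
      have h3 := Real.log_le_log (pos u hu hz hru (n + 1)) (hu (n + 1)).2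
      have h4 := Real.log_le_log (pos v hv hv0 hrv (n + 1)) (hv (n + 1)).2
      simp only [abs_le]
      constructor <;> linarith
  · simp only [hlog u hu hz hru, hlog v hv hv0 hrv]
    exact mono _ _ (gt_one u hu hz hru n)
      ((Real.log_lt_log_iff (pos u hu hz hru _) (pos v hv hv0 hrv _)).1 h) (hv _).2
  · simp only [hlog u hu hz hru, hlog v hv hv0 hrv]
    exact mono _ _ (gt_one v hv hv0 hrv n)
      ((Real.log_lt_log_iff (pos v hv hv0 hrv _) (pos u hu hz hru _)).1 h) (hu _).2

/-- The explicit solutions are `3 / ((p + n) ^ 2 - 1)`. Matching `a 0` gives `p = √(3 + a 0) / √(a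
0)`, and `a 0 ≤ 1` gives `p ≥ 2`. The zero solution is the limit `p = ∞`, treated separately. -/
theorem second_term_of_two_mul_div {a : ℕ → ℝ} (ha : ∀ n, a n ∈ Set.Icc (0 : ℝ) 1)
    (ha1 : ∀ n, a (n + 1) < 1)
    (hra : ∀ n, a n + a (n + 2) - 2 * a (n + 1) = 2 * (a (n + 1) ^ 2 / (1 - a (n + 1)))) :
    a 1 = 3 * a 0 / (√(3 + a 0) * (√(3 + a 0) + 2 * √(a 0))) := by
  obtain hz | hz := (ha 0).1.eq_or_lt
  · rw [← hz]
    simpa using eq_of_bounded_solutions_of_div (b := 0) zero_le_two ha (by simp) ha1 (by simp)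
      (by simp [hz]) hra (by simp)
  set s := √(a 0) with hs
  set r := √(3 + a 0) with hr
  have hs0 : 0 < s := Real.sqrt_pos.2 hz
  have hr0 : 0 < r := Real.sqrt_pos.2 (by linarith)
  have hs2 : s ^ 2 = a 0 := Real.sq_sqrt hz.le
  have hr2 : r ^ 2 = 3 + a 0 := Real.sq_sqrt (by linarith)
  have hp : 2 ≤ r / s := by
    rw [le_div_iff₀ hs0]
    exact le_of_sq_le_sq (by nlinarith [(ha 0).2]) hr0.le
  set p := r / s with hpd
  have hrp : r = p * s := by rw [hpd]; field_simp
  have hsp : s ^ 2 * (p ^ 2 - 1) = 3 := by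
    rw [hrp] at hr2; linear_combination hr2 - hs2
  have hn : ∀ n : ℕ, (0 : ℝ) ≤ n := fun n => n.cast_nonneg
  have h0 : a 0 = 3 / ((p + (0 : ℕ)) ^ 2 - 1) := by
    rw [← hs2, eq_div_iff (by push_cast; nlinarith)]
    push_cast; linear_combination hsp
  have hle : ∀ n : ℕ, 3 / ((p + n) ^ 2 - 1) ∈ Set.Icc (0 : ℝ) 1 := by
    intro n
    have : 3 ≤ (p + n) ^ 2 - 1 := by nlinarith [hn n]
    exact ⟨by positivity, (div_le_one (by linarith)).2 this⟩
  rw [eq_of_bounded_solutions_of_div (b := fun n : ℕ => 3 / ((p + n) ^ 2 - 1)) zero_le_two ha hle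
    ha1 (fun n => ?_) h0 hra (fun n => ?_)]
  · rw [← hs2, hrp]
    have h1 : (p + (1 : ℕ)) ^ 2 - 1 ≠ 0 := by push_cast; nlinarith
    have h2 : p + 2 ≠ 0 := by linarith
    have h3 : p ≠ 0 := by linarith
    push_cast at h1 ⊢
    rw [show p * s * (p * s + 2 * s) = s ^ 2 * ((p + 1) ^ 2 - 1) by ring]
    field_simp
  · have : 3 < (p + (n + 1 : ℕ)) ^ 2 - 1 := by push_cast; nlinarith [hn n]
    exact (div_lt_one (by linarith)).2 this
  -- Centring at the middle index makes all denominators and `1 - b (n + 1)` factor linearly in `q`.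
  · obtain ⟨q, hq⟩ : ∃ q, q = p + n + 1 := ⟨_, rfl⟩
    have hq3 : 3 ≤ q := by linarith [hn n]
    push_cast
    rw [show p + (n : ℝ) = q - 1 by rw [hq]; ring, show p + ((n : ℝ) + 1) = q by rw [hq]; ring,
      show p + ((n : ℝ) + 2) = q + 1 by rw [hq]; ring,
      show (q - 1) ^ 2 - 1 = q * (q - 2) by ring, show (q + 1) ^ 2 - 1 = q * (q + 2) by ring]
    have h1 : q ^ 2 - 1 ≠ 0 := by nlinarith
    have h2 : q - 2 ≠ 0 := by linarith
    have h3 : q + 2 ≠ 0 := by linarith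
    have h4 : q ≠ 0 := by linarith
    rw [one_sub_div h1, show q ^ 2 - 1 - 3 = (q - 2) * (q + 2) by ring]
    field_simp
    ring

/-- Here the solutions are `2 / ((p + n) ^ 2 - 1 / 4)`, and matching `a 0` gives `p = √(8 + a 0) /
(2 √(a 0))`. -/
theorem second_term_of_three_mul_div {a : ℕ → ℝ} (ha : ∀ n, a n ∈ Set.Icc (0 : ℝ) 1)
    (ha1 : ∀ n, a (n + 1) < 1)
    (hra : ∀ n, a n + a (n + 2) - 2 * a (n + 1) = 3 * (a (n + 1) ^ 2 / (1 - a (n + 1)))) :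
    a 1 = 8 * a 0 / ((√(8 + a 0) + √(a 0)) * (√(8 + a 0) + 3 * √(a 0))) := by
  obtain hz | hz := (ha 0).1.eq_or_lt
  · rw [← hz]
    simpa using eq_of_bounded_solutions_of_div (b := 0) zero_le_three ha (by simp) ha1 (by simp)
      (by simp [hz]) hra (by simp)
  set s := √(a 0) with hs
  set r := √(8 + a 0) with hr
  have hs0 : 0 < s := Real.sqrt_pos.2 hz
  have hr0 : 0 < r := Real.sqrt_pos.2 (by linarith)
  have hs2 : s ^ 2 = a 0 := Real.sq_sqrt hz.le
  have hr2 : r ^ 2 = 8 + a 0 := Real.sq_sqrt (by linarith)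
  have hp : 3 / 2 ≤ r / (2 * s) := by
    rw [le_div_iff₀ (by positivity)]
    exact le_of_sq_le_sq (by nlinarith [(ha 0).2]) hr0.le
  set p := r / (2 * s) with hpd
  have hrp : r = p * (2 * s) := by rw [hpd]; field_simp
  have hsp : s ^ 2 * (p ^ 2 - 1 / 4) = 2 := by
    rw [hrp] at hr2; linear_combination (hr2 - hs2) / 4
  have hn : ∀ n : ℕ, (0 : ℝ) ≤ n := fun n => n.cast_nonneg
  have h0 : a 0 = 2 / ((p + (0 : ℕ)) ^ 2 - 1 / 4) := by
    rw [← hs2, eq_div_iff (by push_cast; nlinarith)]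
    push_cast; linear_combination hsp
  have hle : ∀ n : ℕ, 2 / ((p + n) ^ 2 - 1 / 4) ∈ Set.Icc (0 : ℝ) 1 := by
    intro n
    have : 2 ≤ (p + n) ^ 2 - 1 / 4 := by nlinarith [hn n]
    exact ⟨by positivity, (div_le_one (by linarith)).2 this⟩
  rw [eq_of_bounded_solutions_of_div (b := fun n : ℕ => 2 / ((p + n) ^ 2 - 1 / 4)) zero_le_three
    ha hle ha1 (fun n => ?_) h0 hra (fun n => ?_)]
  · rw [← hs2, hrp]
    have h1 : (p + (1 : ℕ)) ^ 2 - 1 / 4 ≠ 0 := by push_cast; nlinarith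
    push_cast at h1 ⊢
    rw [show (p * (2 * s) + s) * (p * (2 * s) + 3 * s) = 4 * s ^ 2 * ((p + 1) ^ 2 - 1 / 4) by ring,
      div_eq_div_iff h1 (by positivity)]
    ring
  · have : 2 < (p + (n + 1 : ℕ)) ^ 2 - 1 / 4 := by push_cast; nlinarith [hn n]
    exact (div_lt_one (by linarith)).2 this
  · obtain ⟨q, hq⟩ : ∃ q, q = p + n + 1 := ⟨_, rfl⟩
    have hq3 : 5 / 2 ≤ q := by linarith [hn n]
    push_cast
    rw [show p + (n : ℝ) = q - 1 by rw [hq]; ring, show p + ((n : ℝ) + 1) = q by rw [hq]; ring,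
      show p + ((n : ℝ) + 2) = q + 1 by rw [hq]; ring,
      show (q - 1) ^ 2 - 1 / 4 = (q - 1 / 2) * (q - 3 / 2) by ring,
      show (q + 1) ^ 2 - 1 / 4 = (q + 1 / 2) * (q + 3 / 2) by ring,
      show q ^ 2 - 1 / 4 = (q - 1 / 2) * (q + 1 / 2) by ring]
    have h1 : q - 1 / 2 ≠ 0 := by linarith
    have h2 : q + 1 / 2 ≠ 0 := by linarith
    have h3 : q - 3 / 2 ≠ 0 := by linarith
    have h4 : q + 3 / 2 ≠ 0 := by linarith
    rw [one_sub_div (mul_ne_zero h1 h2),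
      show (q - 1 / 2) * (q + 1 / 2) - 2 = (q - 3 / 2) * (q + 3 / 2) by ring]
    rw [div_add_div _ _ (mul_ne_zero h1 h3) (mul_ne_zero h2 h4), mul_div_assoc',
      div_sub_div _ _ (mul_ne_zero (mul_ne_zero h1 h3) (mul_ne_zero h2 h4)) (mul_ne_zero h1 h2),
      div_pow, div_div_div_eq, mul_div_assoc',
      div_eq_div_iff (by positivity) (by positivity)]
    ring

/-- The solutions are `2 - 12 / ((p + n) ^ 2 - 1 / 4)` with `p = r / (2 s)`. The parameter `k`
covers both binary models: `v = 1 + h` with `k = 2` and `v = 2 h` with `k = 1`, where `s ^ 2 = 1 - h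
0`. -/
theorem second_term_of_mul {v : ℕ → ℝ} {k r s : ℝ} (hv : ∀ n, v n ∈ Set.Icc (0 : ℝ) 2)
    (hk : 0 < k) (hs : 0 ≤ s) (hr : 0 < r) (hrs : r ^ 2 = 24 * k + s ^ 2)
    (h0 : v 0 = 2 - 2 * s ^ 2 / k) (hrv : ∀ n, v n * v (n + 2) = 4 * (v (n + 1) - 1)) :
    v 1 = 2 - 48 * s ^ 2 / ((r + s) * (r + 3 * s)) := by
  obtain rfl | hs0 := hs.eq_or_lt
  · simpa using eq_of_bounded_solutions_of_mul (u := fun _ => 2) (by simp) hv (by simp [h0])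
      (by norm_num) hrv
  -- Nonnegativity of `v 0` yields `r ^ 2 ≥ 25 s ^ 2`, so `p ≥ 5 / 2`, which keeps the explicit
  -- solution in `[0, 2]`.
  have ht : s ^ 2 ≤ k := by
    have := (hv 0).1
    rw [h0, sub_nonneg, div_le_iff₀ hk] at this
    linarith
  have hp : 5 / 2 ≤ r / (2 * s) := by
    rw [le_div_iff₀ (by positivity)]
    exact le_of_sq_le_sq (by nlinarith) hr.le
  set p := r / (2 * s) with hpd
  have hrp : r = p * (2 * s) := by rw [hpd]; field_simp
  have hsp : s ^ 2 * (p ^ 2 - 1 / 4) = 6 * k := by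
    rw [hrp] at hrs; linear_combination hrs / 4
  have hn : ∀ n : ℕ, (0 : ℝ) ≤ n := fun n => n.cast_nonneg
  have h0' : v 0 = 2 - 12 / ((p + (0 : ℕ)) ^ 2 - 1 / 4) := by
    rw [h0, sub_right_inj, div_eq_div_iff hk.ne' (by push_cast; nlinarith)]
    push_cast; linear_combination 2 * hsp
  have hle : ∀ n : ℕ, 2 - 12 / ((p + n) ^ 2 - 1 / 4) ∈ Set.Icc (0 : ℝ) 2 := by
    intro n
    have : 6 ≤ (p + n) ^ 2 - 1 / 4 := by nlinarith [hn n]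
    have h1 : 12 / ((p + n) ^ 2 - 1 / 4) ≤ 2 := (div_le_iff₀ (by linarith)).2 (by linarith)
    have h2 : 0 ≤ 12 / ((p + n) ^ 2 - 1 / 4) := by positivity
    constructor <;> linarith
  rw [eq_of_bounded_solutions_of_mul (u := fun n : ℕ => 2 - 12 / ((p + n) ^ 2 - 1 / 4)) hle hv h0'
    (fun n => ?_) hrv]
  · rw [hrp]
    have h1 : (p + (1 : ℕ)) ^ 2 - 1 / 4 ≠ 0 := by push_cast; nlinarith
    push_cast at h1 ⊢
    rw [show (p * (2 * s) + s) * (p * (2 * s) + 3 * s) = 4 * s ^ 2 * ((p + 1) ^ 2 - 1 / 4) by ring,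
      sub_right_inj, div_eq_div_iff h1 (by positivity)]
    ring
  · obtain ⟨q, hq⟩ : ∃ q, q = p + n + 1 := ⟨_, rfl⟩
    have hq3 : 7 / 2 ≤ q := by linarith [hn n]
    push_cast
    rw [show p + (n : ℝ) = q - 1 by rw [hq]; ring, show p + ((n : ℝ) + 1) = q by rw [hq]; ring,
      show p + ((n : ℝ) + 2) = q + 1 by rw [hq]; ring,
      show (q - 1) ^ 2 - 1 / 4 = (q - 1 / 2) * (q - 3 / 2) by ring,
      show (q + 1) ^ 2 - 1 / 4 = (q + 1 / 2) * (q + 3 / 2) by ring,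
      show q ^ 2 - 1 / 4 = (q - 1 / 2) * (q + 1 / 2) by ring]
    have h1 : q - 1 / 2 ≠ 0 := by linarith
    have h2 : q + 1 / 2 ≠ 0 := by linarith
    have h3 : q - 3 / 2 ≠ 0 := by linarith
    have h4 : q + 3 / 2 ≠ 0 := by linarith
    rw [sub_div' (mul_ne_zero h1 h3), sub_div' (mul_ne_zero h2 h4), sub_div' (mul_ne_zero h1 h2),
      div_sub_one (mul_ne_zero h1 h2), div_mul_div_comm, mul_div_assoc',
      div_eq_div_iff (by positivity) (by positivity)]
    ring

/-! ### The step functions of the four models. -/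

theorem PMF.apply_eq_one_of_unique {α : Type*} [Unique α] (p : PMF α) (a : α) : p a = 1 := by
  rw [← p.tsum_coe, tsum_eq_single a fun b hb => (hb (Subsingleton.elim _ _)).elim]

namespace LTree

theorem sum_iidSteps_mul_prod (u : PMF SignType) (k : ℕ) (φ : SignType → ℝ≥0∞) :
    ∑ s : Fin k → SignType, iidSteps u k s * ∏ i, φ (s i) = (∑ a, u a * φ a) ^ k := by
  have := Finset.sum_prod_piFinset (ι := Fin k) Finset.univ (fun _ a => u a * φ a)
  simp only [Fintype.piFinset_univ, Finset.prod_const, Finset.card_univ, Fintype.card_fin] at this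
  rw [← this]
  simp [iidSteps, Finset.prod_mul_distrib]

/-- With `A` the mean of `f` over one displacement, the sum is the geometric series of `2⁻¹ * (A /
2) ^ k`. Nothing is needed about `η 0`, since only one law exists on the empty vector. -/
theorem offspring_critGeometric {η : (k : ℕ) → PMF (Fin k → SignType)} {u : PMF SignType}
    (hη : ∀ k, 1 ≤ k → η k = iidSteps u k) {f : ℤ → ℝ≥0∞} (hf : ∀ x, f x ≤ 1) (x : ℤ) :
    (offspring critGeometric η f x).toReal =
      1 / (2 - ∑ a : SignType, (u a).toReal * (f (x + (a : ℤ))).toReal) := by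
  have hη' : ∀ k, η k = iidSteps u k := by
    intro k
    obtain rfl | hk := k.eq_zero_or_pos
    · ext s; simp only [PMF.apply_eq_one_of_unique]
    · exact hη k hk
  set A := ∑ a : SignType, u a * f (x + (a : ℤ)) with hA
  have hA1 : A ≤ 1 := by
    calc A ≤ ∑ a, u a := Finset.sum_le_sum fun a _ => mul_le_of_le_one_right' (hf _)
      _ = 1 := by rw [← u.tsum_coe, tsum_fintype]
  have hAr : A.toReal = ∑ a : SignType, (u a).toReal * (f (x + (a : ℤ))).toReal := by
    rw [hA, ENNReal.toReal_sum fun a _ => ENNReal.mul_ne_top (u.apply_ne_top a)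
      (ne_top_of_le_ne_top ENNReal.one_ne_top (hf _))]
    simp
  have hAt := ne_top_of_le_ne_top ENNReal.one_ne_top hA1
  have hAI := toReal_mem_Icc hA1
  have : offspring critGeometric η f x = ∑' k : ℕ, 2⁻¹ * (2⁻¹ * A) ^ k := by
    rw [offspring]
    refine tsum_congr fun k => ?_
    rw [hη', sum_iidSteps_mul_prod u k fun a => f (x + (a : ℤ)), mul_pow, ← mul_assoc, ← pow_succ']
    rfl
  rw [this, ENNReal.tsum_toReal_eq fun k => by finiteness, ← hAr]
  simp only [ENNReal.toReal_mul, ENNReal.toReal_pow, ENNReal.toReal_inv, ENNReal.toReal_ofNat]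
  rw [tsum_mul_left, tsum_geometric_of_lt_one (by linarith [hAI.1]) (by linarith [hAI.2]),
    ← mul_inv, one_div]
  congr 1
  ring

theorem isStep_critGeometric_pm_one {η : (k : ℕ) → PMF (Fin k → SignType)}
    (hη : ∀ k, 1 ≤ k → η k = iidSteps (PMF.uniformOfFinset {-1, 1} (by simp)) k) :
    IsStep critGeometric η fun a _ c => 1 / (2 - (a + c) / 2) := by
  intro f hf x
  have h : Finset.card ({-1, 1} : Finset SignType) = 2 := rfl
  rw [offspring_critGeometric hη hf, SignType.univ_eq]
  congr 2
  simp [PMF.uniformOfFinset_apply, h, ← sub_eq_add_neg]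
  ring

theorem isStep_critGeometric_uniform {η : (k : ℕ) → PMF (Fin k → SignType)}
    (hη : ∀ k, 1 ≤ k → η k = iidSteps (PMF.uniformOfFinset {-1, 0, 1} (by simp)) k) :
    IsStep critGeometric η fun a b c => 1 / (2 - (a + b + c) / 3) := by
  intro f hf x
  have h : Finset.card ({-1, 0, 1} : Finset SignType) = 3 := rfl
  rw [offspring_critGeometric hη hf, SignType.univ_eq]
  congr 2
  simp [PMF.uniformOfFinset_apply, h, ← sub_eq_add_neg]
  ring

theorem sum_zero_steps (p : PMF (Fin 0 → SignType)) (f : ℤ → ℝ≥0∞) (x : ℤ) :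
    ∑ s : Fin 0 → SignType, p s * ∏ i, f (x + (s i : ℤ)) = 1 := by
  simp [PMF.apply_eq_one_of_unique]

theorem sum_pair_steps (f : ℤ → ℝ≥0∞) (x : ℤ) :
    ∑ s : Fin 2 → SignType, PMF.pure ![-1, 1] s * ∏ i, f (x + (s i : ℤ)) =
      f (x - 1) * f (x + 1) := by
  rw [Finset.sum_eq_single ![-1, 1] (fun s _ hs => by simp [PMF.pure_apply, hs]) (by simp)]
  simp [← sub_eq_add_neg]

theorem sum_single_steps (f : ℤ → ℝ≥0∞) (x : ℤ) :
    ∑ s : Fin 1 → SignType, PMF.uniformOfFinset {![-1], ![1]} (by simp) s *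
      ∏ i, f (x + (s i : ℤ)) = 2⁻¹ * (f (x - 1) + f (x + 1)) := by
  have hne : (![-1] : Fin 1 → SignType) ≠ ![1] := by decide
  have h : Finset.card ({![-1], ![1]} : Finset (Fin 1 → SignType)) = 2 := rfl
  rw [← Finset.sum_subset (Finset.subset_univ {![-1], ![1]}) (fun s _ hs => by
    rw [PMF.uniformOfFinset_apply_of_notMem _ hs, zero_mul]), Finset.sum_pair hne]
  simp [PMF.uniformOfFinset_apply, h, ← sub_eq_add_neg, mul_add]

theorem isStep_incompleteBinary {η : (k : ℕ) → PMF (Fin k → SignType)}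
    (h1 : η 1 = PMF.uniformOfFinset {![-1], ![1]} (by simp)) (h2 : η 2 = PMF.pure ![-1, 1]) :
    IsStep incompleteBinary η fun a _ c => (1 + a) * (1 + c) / 4 := by
  intro f hf x
  have ht := fun y => ne_top_of_le_ne_top ENNReal.one_ne_top (hf y)
  rw [offspring, tsum_eq_sum (s := {0, 1, 2}) fun k hk => by
    rw [incompleteBinary, PMF.ofFinset_apply_of_notMem _ _ hk, zero_mul]]
  simp only [Finset.mem_insert, Finset.mem_singleton, Finset.sum_insert, Finset.sum_singleton,
    zero_ne_one, OfNat.zero_ne_ofNat, OfNat.one_ne_ofNat, or_self, not_false_eq_true]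
  rw [sum_zero_steps, h1, h2, sum_pair_steps, sum_single_steps]
  simp only [incompleteBinary, PMF.ofFinset_apply]
  norm_num
  have := ht (x - 1)
  have := ht (x + 1)
  rw [ENNReal.toReal_add (by finiteness) (by finiteness),
    ENNReal.toReal_add (by finiteness) (by finiteness)]
  simp only [ENNReal.toReal_mul, ENNReal.toReal_inv, ENNReal.toReal_ofNat,
    ENNReal.toReal_add (ht (x - 1)) (ht (x + 1))]
  ring

theorem isStep_completeBinary {η : (k : ℕ) → PMF (Fin k → SignType)}
    (h2 : η 2 = PMF.pure ![-1, 1]) :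
    IsStep completeBinary η fun a _ c => (1 + a * c) / 2 := by
  intro f hf x
  have ht := fun y => ne_top_of_le_ne_top ENNReal.one_ne_top (hf y)
  have h : Finset.card ({0, 2} : Finset ℕ) = 2 := rfl
  rw [offspring, tsum_eq_sum (s := {0, 2}) fun k hk => by
    rw [completeBinary, PMF.uniformOfFinset_apply_of_notMem _ hk, zero_mul]]
  rw [Finset.sum_pair (by norm_num), sum_zero_steps, h2, sum_pair_steps]
  simp only [completeBinary, PMF.uniformOfFinset_apply, h]
  have := ht (x - 1)
  have := ht (x + 1)
  norm_num
  rw [ENNReal.toReal_add (by finiteness) (by finiteness)]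
  simp only [ENNReal.toReal_mul, ENNReal.toReal_inv, ENNReal.toReal_ofNat]
  ring

/-! ### Hitting laws in unsimplified form. -/

theorem hitLaw_critGeometric_pm_one {η : (k : ℕ) → PMF (Fin k → SignType)}
    (hη : ∀ k, 1 ≤ k → η k = iidSteps (PMF.uniformOfFinset {-1, 1} (by simp)) k) :
    (∑' n, nuPlus critGeometric η n) = 1 ∧ nuMinus critGeometric η = nuPlus critGeometric η ∧
      ∀ z : ℝ, 0 ≤ z → z ≤ 1 → genFun (nuPlus critGeometric η) z =
        1 - 3 * (1 - z) / (√(4 - z) * (√(4 - z) + 2 * √(1 - z))) := by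
  -- In terms of `w = 1 - h` the step says that the neighbours' mean is `w / (1 - w)`. The resulting
  -- second difference is nonnegative, which also gives concavity of `h`.
  have hw : ∀ a ∈ Set.Icc (0 : ℝ) 1, ∀ b ∈ Set.Icc (0 : ℝ) 1, ∀ c ∈ Set.Icc (0 : ℝ) 1,
      b = 1 / (2 - (a + c) / 2) → 1 - b < 1 ∧
        (1 - a) + (1 - c) - 2 * (1 - b) = 2 * ((1 - b) ^ 2 / (1 - (1 - b))) := by
    intro a ha b hb c hc h
    have hd : 0 < 2 - (a + c) / 2 := by linarith [ha.2, hc.2]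
    have hb0 : 0 < b := h ▸ by positivity
    refine ⟨by linarith, ?_⟩
    rw [eq_div_iff hd.ne'] at h
    rw [sub_sub_cancel, mul_div_assoc', eq_div_iff hb0.ne']
    linear_combination 2 * h
  refine hitLaw_of_isStep (isStep_critGeometric_pm_one hη) (fun a b c => by ring)
    (fun a ha b hb c hc h => ?_) (fun b hb h => ?_) fun h hI hr => ?_
  · have := (hw a ha b hb c hc h).2
    have : 0 ≤ 2 * ((1 - b) ^ 2 / (1 - (1 - b))) := by rw [sub_sub_cancel]; have := hb.1; positivity
    linarith
  · have hd : 2 - (b + b) / 2 ≠ 0 := by linarith [hb.2]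
    rw [eq_div_iff hd] at h
    nlinarith
  · have hI' : ∀ n, 1 - h n ∈ Set.Icc (0 : ℝ) 1 :=
      fun n => ⟨by linarith [(hI n).2], by linarith [(hI n).1]⟩
    have hk := fun n => hw _ (hI n) _ (hI (n + 1)) _ (hI (n + 2)) (hr n)
    have := second_term_of_two_mul_div (a := fun n => 1 - h n) hI' (fun n => (hk n).1)
      fun n => (hk n).2
    simp only [show 3 + (1 - h 0) = 4 - h 0 by ring] at this
    linarith

theorem hitLaw_critGeometric_uniform {η : (k : ℕ) → PMF (Fin k → SignType)}
    (hη : ∀ k, 1 ≤ k → η k = iidSteps (PMF.uniformOfFinset {-1, 0, 1} (by simp)) k) :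
    (∑' n, nuPlus critGeometric η n) = 1 ∧ nuMinus critGeometric η = nuPlus critGeometric η ∧
      ∀ z : ℝ, 0 ≤ z → z ≤ 1 → genFun (nuPlus critGeometric η) z =
        1 - 8 * (1 - z) / ((√(9 - z) + √(1 - z)) * (√(9 - z) + 3 * √(1 - z))) := by
  have hw : ∀ a ∈ Set.Icc (0 : ℝ) 1, ∀ b ∈ Set.Icc (0 : ℝ) 1, ∀ c ∈ Set.Icc (0 : ℝ) 1,
      b = 1 / (2 - (a + b + c) / 3) → 1 - b < 1 ∧
        (1 - a) + (1 - c) - 2 * (1 - b) = 3 * ((1 - b) ^ 2 / (1 - (1 - b))) := by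
    intro a ha b hb c hc h
    have hd : 0 < 2 - (a + b + c) / 3 := by linarith [ha.2, hb.2, hc.2]
    have hb0 : 0 < b := by rw [h]; positivity
    refine ⟨by linarith, ?_⟩
    rw [eq_div_iff hd.ne'] at h
    rw [sub_sub_cancel, mul_div_assoc', eq_div_iff hb0.ne']
    linear_combination 3 * h
  refine hitLaw_of_isStep (isStep_critGeometric_uniform hη) (fun a b c => by ring)
    (fun a ha b hb c hc h => ?_) (fun b hb h => ?_) fun h hI hr => ?_
  · have := (hw a ha b hb c hc h).2
    have : 0 ≤ 3 * ((1 - b) ^ 2 / (1 - (1 - b))) := by rw [sub_sub_cancel]; have := hb.1; positivity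
    linarith
  · have hd : 2 - (b + b + b) / 3 ≠ 0 := by linarith [hb.2]
    rw [eq_div_iff hd] at h
    nlinarith
  · have hI' : ∀ n, 1 - h n ∈ Set.Icc (0 : ℝ) 1 :=
      fun n => ⟨by linarith [(hI n).2], by linarith [(hI n).1]⟩
    have hk := fun n => hw _ (hI n) _ (hI (n + 1)) _ (hI (n + 2)) (hr n)
    have := second_term_of_three_mul_div (a := fun n => 1 - h n) hI' (fun n => (hk n).1)
      fun n => (hk n).2
    simp only [show 8 + (1 - h 0) = 9 - h 0 by ring] at this
    linarith

theorem hitLaw_incompleteBinary {η : (k : ℕ) → PMF (Fin k → SignType)}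
    (h1 : η 1 = PMF.uniformOfFinset {![-1], ![1]} (by simp)) (h2 : η 2 = PMF.pure ![-1, 1]) :
    (∑' n, nuPlus incompleteBinary η n) = 1 ∧
      nuMinus incompleteBinary η = nuPlus incompleteBinary η ∧
      ∀ z : ℝ, 0 ≤ z → z ≤ 1 → genFun (nuPlus incompleteBinary η) z =
        1 - 48 * (1 - z) / ((√(49 - z) + √(1 - z)) * (√(49 - z) + 3 * √(1 - z))) := by
  refine hitLaw_of_isStep (isStep_incompleteBinary h1 h2) (fun a b c => by ring)
    (fun a ha b hb c hc h => ?_) (fun b hb h => ?_) fun h hI hr => ?_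
  -- Concavity amounts to `(1 - a) (1 - c) ≥ 0`.
  · nlinarith [mul_nonneg (sub_nonneg.2 ha.2) (sub_nonneg.2 hc.2)]
  · nlinarith
  · have hz := hI 0
    have hs2 : √(1 - h 0) ^ 2 = 1 - h 0 := Real.sq_sqrt (by linarith [hz.2])
    have := second_term_of_mul (v := fun n => 1 + h n) (k := 2) (r := √(49 - h 0))
      (s := √(1 - h 0)) (fun n => ⟨by linarith [(hI n).1], by linarith [(hI n).2]⟩) two_pos
      (Real.sqrt_nonneg _) (Real.sqrt_pos.2 (by linarith [hz.2]))
      (by rw [hs2, Real.sq_sqrt (by linarith [hz.2])]; ring) (by rw [hs2]; ring)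
      fun n => by linarith [hr n]
    rw [hs2] at this
    linarith

theorem hitLaw_completeBinary {η : (k : ℕ) → PMF (Fin k → SignType)}
    (h2 : η 2 = PMF.pure ![-1, 1]) :
    (∑' n, nuPlus completeBinary η n) = 1 ∧
      nuMinus completeBinary η = nuPlus completeBinary η ∧
      ∀ z : ℝ, 0 ≤ z → z ≤ 1 → genFun (nuPlus completeBinary η) z =
        1 - 24 * (1 - z) / ((√(25 - z) + √(1 - z)) * (√(25 - z) + 3 * √(1 - z))) := by
  refine hitLaw_of_isStep (isStep_completeBinary h2) (fun a b c => by ring)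
    (fun a ha b hb c hc h => ?_) (fun b hb h => ?_) fun h hI hr => ?_
  · nlinarith [mul_nonneg (sub_nonneg.2 ha.2) (sub_nonneg.2 hc.2)]
  · nlinarith
  · have hz := hI 0
    have hs2 : √(1 - h 0) ^ 2 = 1 - h 0 := Real.sq_sqrt (by linarith [hz.2])
    have := second_term_of_mul (v := fun n => 2 * h n) (k := 1) (r := √(25 - h 0))
      (s := √(1 - h 0)) (fun n => ⟨by linarith [(hI n).1], by linarith [(hI n).2]⟩) one_pos
      (Real.sqrt_nonneg _) (Real.sqrt_pos.2 (by linarith [hz.2]))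
      (by rw [hs2, Real.sq_sqrt (by linarith [hz.2])]; ring) (by rw [hs2]; ring)
      fun n => by linarith [hr n]
    rw [hs2] at this
    linear_combination this / 2

end LTree

/-! ### Closed forms and the value at zero. -/

theorem rpow_three_halves {x : ℝ} (hx : 0 ≤ x) : x ^ (3 / 2 : ℝ) = x * √x := by
  rw [Real.sqrt_eq_rpow, ← Real.rpow_one_add' hx (by norm_num)]
  norm_num

/-- The denominator is `K + 4 s ^ 2 + 4 r s`, and its product with the conjugate is `K (K - 8 s ^
2)`. With `s ^ 2 = 1 - z` and `K = 8` this vanishes at `z = 0`, the removable singularity of case 2.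
-/
theorem rationalize_div {K r s : ℝ} (hr : 0 < r) (hs : 0 ≤ s) (hrs : r ^ 2 = K + s ^ 2)
    (hK : K - 8 * s ^ 2 ≠ 0) : K * s ^ 2 / ((r + s) * (r + 3 * s)) =
      s ^ 2 * (K + 4 * s ^ 2 - 4 * (r * s)) / (K - 8 * s ^ 2) := by
  rw [div_eq_div_iff (by positivity) hK]
  obtain rfl : K = r ^ 2 - s ^ 2 := by linarith
  ring

theorem critGeometric_pm_one_formula {z : ℝ} (h0 : 0 < z) (h1 : z ≤ 1) :
    1 - 3 * (1 - z) / (√(4 - z) * (√(4 - z) + 2 * √(1 - z))) =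
      (-2 * z ^ 2 + 9 * z - 4 + 2 * √(4 - z) * (1 - z) ^ (3 / 2 : ℝ)) / (z * (4 - z)) := by
  have hs2 := Real.sq_sqrt (show 0 ≤ 1 - z by linarith)
  have hr2 := Real.sq_sqrt (show 0 ≤ 4 - z by linarith)
  have hr : 0 < √(4 - z) := Real.sqrt_pos.2 (by linarith)
  have hd : 0 < 4 - z := by linarith
  have : 3 * (1 - z) / (√(4 - z) * (√(4 - z) + 2 * √(1 - z))) =
      (1 - z) * (4 - z - 2 * (√(4 - z) * √(1 - z))) / (z * (4 - z)) := by
    rw [div_eq_div_iff (by positivity) (by positivity)]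
    generalize √(1 - z) = s at *
    generalize √(4 - z) = r at *
    linear_combination (1 - z) * (4 * r ^ 2 * hs2 - (3 * z - 2 * (r * s)) * hr2)
  rw [rpow_three_halves (by linarith), this]
  field_simp
  ring

theorem critGeometric_uniform_formula {z : ℝ} (h0 : 0 < z) (h1 : z ≤ 1) :
    1 - 8 * (1 - z) / ((√(9 - z) + √(1 - z)) * (√(9 - z) + 3 * √(1 - z))) =
      (-z ^ 2 + 6 * z - 3 + √(9 - z) * (1 - z) ^ (3 / 2 : ℝ)) / (2 * z) := by
  have hs2 := Real.sq_sqrt (show 0 ≤ 1 - z by linarith)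
  have hr2 := Real.sq_sqrt (show 0 ≤ 9 - z by linarith)
  have := rationalize_div (K := 8) (Real.sqrt_pos.2 (show 0 < 9 - z by linarith))
    (Real.sqrt_nonneg (1 - z)) (by linarith) (by linarith)
  rw [hs2] at this
  rw [rpow_three_halves (by linarith), this, show 8 - 8 * (1 - z) = 8 * z by ring]
  field_simp
  ring

theorem incompleteBinary_formula {z : ℝ} (h0 : 0 ≤ z) (h1 : z ≤ 1) :
    1 - 48 * (1 - z) / ((√(49 - z) + √(1 - z)) * (√(49 - z) + 3 * √(1 - z))) =
      (-z ^ 2 + 16 * z - 3 + √(49 - z) * (1 - z) ^ (3 / 2 : ℝ)) / (2 * (z + 5)) := by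
  have hs2 := Real.sq_sqrt (show 0 ≤ 1 - z by linarith)
  have hr2 := Real.sq_sqrt (show 0 ≤ 49 - z by linarith)
  have := rationalize_div (K := 48) (Real.sqrt_pos.2 (show 0 < 49 - z by linarith))
    (Real.sqrt_nonneg (1 - z)) (by linarith) (by linarith)
  rw [hs2] at this
  rw [rpow_three_halves (by linarith), this, show 48 - 8 * (1 - z) = 8 * (z + 5) by ring]
  field_simp
  ring

theorem completeBinary_formula {z : ℝ} (h0 : 0 ≤ z) (h1 : z ≤ 1) :
    1 - 24 * (1 - z) / ((√(25 - z) + √(1 - z)) * (√(25 - z) + 3 * √(1 - z))) =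
      (-z ^ 2 + 10 * z - 3 + √(25 - z) * (1 - z) ^ (3 / 2 : ℝ)) / (2 * (z + 2)) := by
  have hs2 := Real.sq_sqrt (show 0 ≤ 1 - z by linarith)
  have hr2 := Real.sq_sqrt (show 0 ≤ 25 - z by linarith)
  have := rationalize_div (K := 24) (Real.sqrt_pos.2 (show 0 < 25 - z by linarith))
    (Real.sqrt_nonneg (1 - z)) (by linarith) (by linarith)
  rw [hs2] at this
  rw [rpow_three_halves (by linarith), this, show 24 - 8 * (1 - z) = 8 * (z + 2) by ring]
  field_simp
  ring

/-- A function that agrees on `(0, 1]` with one continuous at `0` tends to the value of the latter. -/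
theorem tendsto_of_eq_of_continuousAt {G E f : ℝ → ℝ} (hG : G 0 = E 0) (hE : ContinuousAt E 0)
    (hf : ∀ z, 0 < z → z ≤ 1 → E z = f z) : Filter.Tendsto f (𝓝[>] 0) (𝓝 (G 0)) := by
  rw [hG]
  refine (hE.tendsto.mono_left nhdsWithin_le_nhds).congr' ?_
  filter_upwards [Ioc_mem_nhdsGT (zero_lt_one' ℝ)] with z hz using hf z hz.1 hz.2

theorem proposition3p4 :
    -- critical geometric offspring, i.i.d. uniform displacements in {-1, 1}
    (∀ η : (k : ℕ) → PMF (Fin k → SignType),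
      (∀ k, 1 ≤ k → η k = iidSteps (PMF.uniformOfFinset {-1, 1} (by simp)) k) →
      (∑' n, nuPlus critGeometric η n) = 1 ∧ nuMinus critGeometric η = nuPlus critGeometric η ∧
      (∀ z : ℝ, 0 < z → z ≤ 1 → genFun (nuPlus critGeometric η) z =
        (-2 * z ^ 2 + 9 * z - 4 + 2 * √(4 - z) * (1 - z) ^ (3 / 2 : ℝ)) / (z * (4 - z))) ∧
      -- the value at 0, where the right-hand side is understood as its limit
      genFun (nuPlus critGeometric η) 0 = 5 / 8 ∧
      Filter.Tendsto (fun z : ℝ =>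
        (-2 * z ^ 2 + 9 * z - 4 + 2 * √(4 - z) * (1 - z) ^ (3 / 2 : ℝ)) / (z * (4 - z)))
        (𝓝[>] 0) (𝓝 (genFun (nuPlus critGeometric η) 0))) ∧
    -- critical geometric offspring, i.i.d. uniform displacements in {-1, 0, 1}
    (∀ η : (k : ℕ) → PMF (Fin k → SignType),
      (∀ k, 1 ≤ k → η k = iidSteps (PMF.uniformOfFinset {-1, 0, 1} (by simp)) k) →
      (∑' n, nuPlus critGeometric η n) = 1 ∧ nuMinus critGeometric η = nuPlus critGeometric η ∧
      (∀ z : ℝ, 0 < z → z ≤ 1 → genFun (nuPlus critGeometric η) z =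
        (-z ^ 2 + 6 * z - 3 + √(9 - z) * (1 - z) ^ (3 / 2 : ℝ)) / (2 * z)) ∧
      genFun (nuPlus critGeometric η) 0 = 2 / 3 ∧
      Filter.Tendsto (fun z : ℝ =>
        (-z ^ 2 + 6 * z - 3 + √(9 - z) * (1 - z) ^ (3 / 2 : ℝ)) / (2 * z))
        (𝓝[>] 0) (𝓝 (genFun (nuPlus critGeometric η) 0))) ∧
    -- incomplete binary trees with natural embedding
    (∀ η : (k : ℕ) → PMF (Fin k → SignType),
      η 1 = PMF.uniformOfFinset {![-1], ![1]} (by simp) →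
      η 2 = PMF.pure ![-1, 1] →
      (∑' n, nuPlus incompleteBinary η n) = 1 ∧
      nuMinus incompleteBinary η = nuPlus incompleteBinary η ∧
      ∀ z : ℝ, 0 ≤ z → z ≤ 1 → genFun (nuPlus incompleteBinary η) z =
        (-z ^ 2 + 16 * z - 3 + √(49 - z) * (1 - z) ^ (3 / 2 : ℝ)) / (2 * (z + 5))) ∧
    -- complete binary trees with natural embedding
    (∀ η : (k : ℕ) → PMF (Fin k → SignType),
      η 2 = PMF.pure ![-1, 1] →
      (∑' n, nuPlus completeBinary η n) = 1 ∧
      nuMinus completeBinary η = nuPlus completeBinary η ∧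
      ∀ z : ℝ, 0 ≤ z → z ≤ 1 → genFun (nuPlus completeBinary η) z =
        (-z ^ 2 + 10 * z - 3 + √(25 - z) * (1 - z) ^ (3 / 2 : ℝ)) / (2 * (z + 2))) := by
  have sqrt4 : √(4 : ℝ) = 2 := by rw [show (4 : ℝ) = 2 ^ 2 by norm_num]; exact Real.sqrt_sq two_pos.le
  have sqrt9 : √(9 : ℝ) = 3 := by
    rw [show (9 : ℝ) = 3 ^ 2 by norm_num]; exact Real.sqrt_sq three_pos.le
  refine ⟨fun η hη => ?_, fun η hη => ?_, fun η h1 h2 => ?_, fun η h2 => ?_⟩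
  · obtain ⟨hm, heq, hg⟩ := LTree.hitLaw_critGeometric_pm_one hη
    have hg0 := hg 0 le_rfl zero_le_one
    refine ⟨hm, heq, fun z h0 h1 => (hg z h0.le h1).trans (critGeometric_pm_one_formula h0 h1), ?_,
      tendsto_of_eq_of_continuousAt hg0 ?_ fun z => critGeometric_pm_one_formula⟩
    · rw [hg0]; norm_num [sqrt4]
    -- The unrationalized denominator is nonzero at `0`, so this form carries both the value and the
    -- limit.
    · refine ContinuousAt.sub (by fun_prop) (ContinuousAt.div (by fun_prop) (by fun_prop) ?_)
      norm_num [sqrt4]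
  · obtain ⟨hm, heq, hg⟩ := LTree.hitLaw_critGeometric_uniform hη
    have hg0 := hg 0 le_rfl zero_le_one
    refine ⟨hm, heq, fun z h0 h1 => (hg z h0.le h1).trans (critGeometric_uniform_formula h0 h1), ?_,
      tendsto_of_eq_of_continuousAt hg0 ?_ fun z => critGeometric_uniform_formula⟩
    · rw [hg0]; norm_num [sqrt9]
    · refine ContinuousAt.sub (by fun_prop) (ContinuousAt.div (by fun_prop) (by fun_prop) ?_)
      norm_num [sqrt9]
  · obtain ⟨hm, heq, hg⟩ := LTree.hitLaw_incompleteBinary h1 h2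
    exact ⟨hm, heq, fun z h0 h1 => (hg z h0 h1).trans (incompleteBinary_formula h0 h1)⟩
  · obtain ⟨hm, heq, hg⟩ := LTree.hitLaw_completeBinary h2
    exact ⟨hm, heq, fun z h0 h1 => (hg z h0 h1).trans (completeBinary_formula h0 h1)⟩
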